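/- Let $r$ be a natural number. C*-algebras are not assumed unital and $*$-homomorphisms are not assumed to preserve units. For $0<p<\infty$ let \[ B_p=C^*\Big\langle x_1,\dots,x_r \;\Big|\; \Big\|\sum_{k=1}^r (x_kx_k^*)^{p/2}\Big\|\le 1\Big\rangle , \] and let $B_\infty=C^*\langle x_1,\dots,x_r \mid \|x_k\|\le 1,\ k=1,\dots,r\rangle$. That is, $B_p$ is a C*-algebra generated by elements $x_1,\dots,x_r$ that satisfy the stated relation, such that for every C*-algebra $D$ and all $y_1,\dots,y_r\in D$ satisfying the same relation there is exactly one $*$-homomorphism $B_p\to D$ with $x_k\mapsto y_k$ for all $k$. Then for every $0<p\le\infty$ the C*-algebra $B_p$ exists and is projective: for every surjective $*$-homomorphism $\rho:A\to C$ of C*-algebras and every $*$-homomorphism $\varphi:B_p\to C$ there is a $*$-homomorphism $\psi:B_p\to A$ with $\rho\circ\psi=\varphi$. -/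

import Mathlib

open scoped ENNReal

universe u v w

/-- The relation defining the noncommutative `ℓ^p` unit ball, for a tuple in a (not necessarily
unital) C⋆-algebra. For finite `p` it is `‖∑ k, (x k * (x k)⋆) ^ (p / 2)‖ ≤ 1`, the power being
taken in the continuous functional calculus without unit: for `0 < p < ∞` the function
`t ↦ t ^ (p / 2)` is continuous and vanishes at `0`, and `x k * (x k)⋆` is positive.
For `p = ∞` it is `‖x k‖ ≤ 1` for all `k`. -/
noncomputable def IsNCBallTuple {A : Type v} [NonUnitalCStarAlgebra A] {r : ℕ} (p : ℝ≥0∞)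
    (x : Fin r → A) : Prop :=
  if p = ∞ then ∀ k, ‖x k‖ ≤ 1
  else ‖∑ k, cfcₙ (fun t : ℝ => t ^ (p.toReal / 2)) (x k * star (x k))‖ ≤ 1

/-- `B`, with the tuple `x`, is the universal C⋆-algebra for the ball relation, in the category of
C⋆-algebras and (not necessarily unital) ⋆-homomorphisms: `x` satisfies the relation, generates `B`
as a C⋆-algebra, and every tuple in a C⋆-algebra satisfying the relation is the image of `x` under
exactly one ⋆-homomorphism. (Since `B` is generated by `x`, the notion does not depend on the
universe `v` of the test algebras.) -/
structure IsUniversalNCBall {r : ℕ} (p : ℝ≥0∞) (B : Type u) [NonUnitalCStarAlgebra B]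
    (x : Fin r → B) : Prop where
  rel : IsNCBallTuple p x
  generates : Dense (NonUnitalStarAlgebra.adjoin ℂ (Set.range x) : Set B)
  existsUnique_hom : ∀ (D : Type v) [NonUnitalCStarAlgebra D] (y : Fin r → D),
    IsNCBallTuple p y → ∃! φ : B →⋆ₙₐ[ℂ] D, ∀ k, φ (x k) = y k

/-- A C⋆-algebra `P` is projective if every ⋆-homomorphism from `P` to `C` lifts through every
surjective ⋆-homomorphism `A → C` of C⋆-algebras. -/
def IsProjectiveCStar (P : Type u) [NonUnitalCStarAlgebra P] : Prop :=
  ∀ (A : Type v) (C : Type w) [NonUnitalCStarAlgebra A] [NonUnitalCStarAlgebra C]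
    (ρ : A →⋆ₙₐ[ℂ] C), Function.Surjective ρ →
    ∀ φ : P →⋆ₙₐ[ℂ] C, ∃ ψ : P →⋆ₙₐ[ℂ] A, ρ.comp ψ = φ

/-! The universal property reduces projectivity to lifting tuples: the images of the generators in
`C` must lift to a tuple in `A` satisfying the same relation. For finite `p`, the signed power `v *
|x| ^ (p / 2)` of `x = v * |x|` turns the relation into `‖∑ z k * star (z k)‖ ≤ 1`, is inverted by
the signed power of exponent `2 / p`, and commutes with ⋆-homomorphisms. So it suffices to lift row
contractions, by cutting down an arbitrary lift with functional calculus
(`exists_lift_rowContraction`). For `p = ∞` each coordinate is lifted as a row of length one. Polar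
decomposition may leave the algebra, so signed powers are defined by odd functional calculus on 2×2
matrices. For existence, the relation bounds every coordinate by 1 and passes to bounded products.
The universal algebra is generated by the diagonal tuple in the product of all models carried by
sets of subsets of `ℕ`; these suffice because finitely generated C⋆-algebras are separable. -/

open scoped CStarAlgebra in
theorem NonUnitalStarAlgHom.continuous_of_cstar {A : Type*} {B : Type*} [NonUnitalCStarAlgebra A]
    [NonUnitalCStarAlgebra B] (φ : A →⋆ₙₐ[ℂ] B) : Continuous φ :=
  map_continuous φ

theorem NonUnitalStarAlgHom.map_cfcₙ_real {A : Type*} {B : Type*} [NonUnitalCStarAlgebra A]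
    [NonUnitalCStarAlgebra B] (φ : A →⋆ₙₐ[ℂ] B) {f : ℝ → ℝ} (hf : Continuous f) (h0 : f 0 = 0)
    {a : A} (ha : IsSelfAdjoint a) : φ (cfcₙ f a) = cfcₙ f (φ a) :=
  φ.map_cfcₙ f a hf.continuousOn h0 φ.continuous_of_cstar ha (ha.map φ)

/-! ### Bounding the size of separable C⋆-algebras -/

/-- A C⋆-algebra structure can be transported along a bijection. -/
theorem exists_nonUnitalCStarAlgebra_of_equiv {S : Type u} {E : Type v} [NonUnitalCStarAlgebra E]
    (e : S ≃ E) : ∃ (_ : NonUnitalCStarAlgebra S) (φ : S →⋆ₙₐ[ℂ] E), Function.Bijective φ := by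
  let r : NonUnitalRing S := e.nonUnitalRing
  let m : Module ℂ S := e.module ℂ
  let f : S ≃+* E := e.ringEquiv
  have hf : Function.Injective f := f.injective
  have hsmul (c : ℂ) (x : S) : f (c • x) = c • f x := (e.linearEquiv ℂ).map_smul c x
  let n : NonUnitalNormedRing S := NonUnitalNormedRing.induced S E f hf
  let st : StarRing S :=
    { star := fun x => f.symm (star (f x))
      star_involutive := fun x => by simp
      star_mul := fun x y => by simp
      star_add := fun x y => by simp }
  have hstar (x : S) : f (star x) = star (f x) := f.apply_symm_apply _
  have hnorm (x : S) : ‖x‖ = ‖f x‖ := rfl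
  let ns : NormedSpace ℂ S :=
    { norm_smul_le := fun a b => by rw [hnorm, hnorm, hsmul]; exact norm_smul_le a (f b) }
  have hiso : Isometry f := AddMonoidHomClass.isometry_of_norm f fun x => (hnorm x).symm
  have : CompleteSpace S :=
    (completeSpace_congr (e := f.toEquiv) hiso.isUniformEmbedding).2 inferInstance
  refine ⟨{ norm_mul_self_le := fun x => ?_, smul_assoc := fun c x y => hf ?_,
            smul_comm := fun c x y => hf ?_, star_smul := fun c x => hf ?_ },
    { toFun := f, map_smul' := hsmul, map_zero' := map_zero f, map_add' := map_add f,
      map_mul' := map_mul f, map_star' := hstar }, f.bijective⟩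
  · rw [hnorm, hnorm, map_mul, hstar, CStarRing.norm_star_mul_self]
  · simp [hsmul, smul_mul_assoc]
  · simp [hsmul, mul_smul_comm]
  · simp [hsmul, hstar]

theorem Subsemigroup.countable_closure {M : Type*} [Semigroup M] {s : Set M} (hs : s.Countable) :
    (Subsemigroup.closure s : Set M).Countable := by
  have := hs.to_subtype
  have : Countable (FreeSemigroup s) :=
    Function.Injective.countable (f := fun x : FreeSemigroup s => (x.head, x.tail))
      fun x y h => FreeSemigroup.ext (congrArg Prod.fst h) (congrArg Prod.snd h)
  let F : FreeSemigroup s →ₙ* M := FreeSemigroup.lift ((↑) : s → M)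
  have hle : Subsemigroup.closure s ≤ F.srange :=
    Subsemigroup.closure_le.2 fun x hx => ⟨FreeSemigroup.of ⟨x, hx⟩, by simp [F]⟩
  exact (Set.countable_range F).mono fun x hx => hle hx

theorem NonUnitalStarAlgebra.isSeparable_adjoin {A : Type*} [NonUnitalCStarAlgebra A] {s : Set A}
    (hs : s.Countable) :
    TopologicalSpace.IsSeparable (NonUnitalStarAlgebra.adjoin ℂ s : Set A) := by
  have h := (Subsemigroup.countable_closure
    (hs.union (hs.preimage star_injective))).isSeparable.span (R := ℂ)
  rw [Set.star_preimage] at h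
  rw [← NonUnitalStarAlgebra.adjoin_eq_span] at h
  exact h

/-- A point is determined by which balls of radius `1 / (n + 1)` about a dense sequence contain it.
-/
theorem exists_injective_set_nat (X : Type*) [MetricSpace X] [TopologicalSpace.SeparableSpace X] :
    ∃ f : X → Set ℕ, Function.Injective f := by
  cases isEmpty_or_nonempty X
  · exact ⟨fun _ => ∅, Function.injective_of_subsingleton _⟩
  let d := TopologicalSpace.denseSeq X
  refine ⟨fun x => {n | dist x (d n.unpair.1) < 1 / ((n.unpair.2 : ℝ) + 1)}, fun x y h => ?_⟩
  by_contra hxy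
  obtain ⟨k, hk⟩ := exists_nat_one_div_lt (half_pos (dist_pos.2 hxy))
  obtain ⟨i, hi⟩ := (TopologicalSpace.denseRange_denseSeq X).exists_dist_lt x
    (Nat.one_div_pos_of_nat (α := ℝ) (n := k))
  have hx : Nat.pair i k ∈ {n : ℕ | dist x (d n.unpair.1) < 1 / ((n.unpair.2 : ℝ) + 1)} := by
    simpa using hi
  have hy := hx
  rw [show {n : ℕ | dist x (d n.unpair.1) < 1 / ((n.unpair.2 : ℝ) + 1)} = _ from h] at hy
  simp only [Set.mem_ofPred_eq, Nat.unpair_pair] at hx hy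
  linarith [dist_triangle_right x y (d i)]

/-! ### Signed powers via odd functions of off-diagonal matrices -/

section SignedPower

attribute [local instance] CStarAlgebra.spectralOrder CStarAlgebra.spectralOrderedRing
  Module.complexToReal

variable {A : Type u} {B : Type v} [NonUnitalCStarAlgebra A] [NonUnitalCStarAlgebra B]

namespace CStarMatrix

/-- The self-adjoint matrix with zero diagonal and off-diagonal entries `x` and `star x`. -/
def offDiag (x : A) : CStarMatrix (Fin 2) (Fin 2) A :=
  ofMatrix !![0, x; star x, 0]

theorem isSelfAdjoint_offDiag (x : A) : IsSelfAdjoint (offDiag x) := by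
  ext i j
  fin_cases i <;> fin_cases j <;> simp [offDiag, star_apply]

theorem map_offDiag (φ : A →⋆ₙₐ[ℂ] B) (x : A) : mapₙₐ φ (offDiag x) = offDiag (φ x) := by
  ext i j
  fin_cases i <;> fin_cases j <;> simp [offDiag, map_apply, map_star]

/-- Conjugation by `diag(1, -1)`. -/
def negOffDiag : CStarMatrix (Fin 2) (Fin 2) A →⋆ₙₐ[ℂ] CStarMatrix (Fin 2) (Fin 2) A where
  toFun M := ofMatrix !![M 0 0, -M 0 1; -M 1 0, M 1 1]
  map_smul' c M := by ext i j; fin_cases i <;> fin_cases j <;> simp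
  map_zero' := by ext i j; fin_cases i <;> fin_cases j <;> simp
  map_add' M N := by ext i j; fin_cases i <;> fin_cases j <;> simp [add_comm]
  map_mul' M N := by
    ext i j; fin_cases i <;> fin_cases j <;> simp [mul_apply, Fin.sum_univ_two, add_comm]
  map_star' M := by ext i j; fin_cases i <;> fin_cases j <;> simp [star_apply]

theorem negOffDiag_offDiag (x : A) : negOffDiag (offDiag x) = -offDiag x := by
  ext i j; fin_cases i <;> fin_cases j <;> simp [negOffDiag, offDiag]

/-- The embedding of `A × A` as diagonal matrices. -/
def diagHom : A × A →⋆ₙₐ[ℂ] CStarMatrix (Fin 2) (Fin 2) A where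
  toFun a := ofMatrix !![a.1, 0; 0, a.2]
  map_smul' c M := by ext i j; fin_cases i <;> fin_cases j <;> simp
  map_zero' := by ext i j; fin_cases i <;> fin_cases j <;> simp
  map_add' M N := by ext i j; fin_cases i <;> fin_cases j <;> simp
  map_mul' M N := by
    ext i j; fin_cases i <;> fin_cases j <;> simp [mul_apply, Fin.sum_univ_two]
  map_star' M := by ext i j; fin_cases i <;> fin_cases j <;> simp [star_apply]

theorem offDiag_mul_self (x : A) : offDiag x * offDiag x = diagHom (x * star x, star x * x) := by
  ext i j
  fin_cases i <;> fin_cases j <;> simp [offDiag, diagHom, mul_apply, Fin.sum_univ_two]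

/-- Conjugation by `diag(1, -1)` negates `offDiag x`, hence negates any odd function of it, which
forces a zero diagonal. Self-adjointness ties the two remaining entries together. -/
theorem cfcₙ_offDiag {f : ℝ → ℝ} (hf : Continuous f) (hodd : ∀ t, f (-t) = -f t) (x : A) :
    cfcₙ f (offDiag x) = offDiag (cfcₙ f (offDiag x) 0 1) := by
  have h0 : f 0 = 0 := by have := hodd 0; simp at this; linarith
  have hX := isSelfAdjoint_offDiag x
  have h : negOffDiag (cfcₙ f (offDiag x)) = -cfcₙ f (offDiag x) := by
    rw [NonUnitalStarAlgHom.map_cfcₙ_real negOffDiag hf h0 hX, negOffDiag_offDiag,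
      ← cfcₙ_comp_neg f (offDiag x) hf.continuousOn h0 hX, ← cfcₙ_neg]
    exact cfcₙ_congr fun t _ => hodd t
  have hsa : star (cfcₙ f (offDiag x)) = cfcₙ f (offDiag x) := cfcₙ_predicate (p := IsSelfAdjoint) f _
  have hdiag (i : Fin 2) : cfcₙ f (offDiag x) i i = 0 := by
    have hi := congrFun (congrFun h i) i
    have h2 : (2 : ℝ) • cfcₙ f (offDiag x) i i = 0 := by
      rw [two_smul, add_eq_zero_iff_eq_neg]
      fin_cases i <;> simpa [negOffDiag] using hi
    exact (smul_eq_zero.1 h2).resolve_left two_ne_zero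
  ext i j
  fin_cases i <;> fin_cases j
  · simpa [offDiag] using hdiag 0
  · simp [offDiag]
  · have := congrFun (congrFun hsa 1) 0
    rw [star_apply] at this
    simpa [offDiag] using this.symm
  · simpa [offDiag] using hdiag 1

end CStarMatrix

open CStarMatrix

/-- The odd real function `t ↦ sign t * |t| ^ s`. -/
noncomputable def Real.signedRpow (s t : ℝ) : ℝ := SignType.sign t * |t| ^ s

theorem Real.signedRpow_of_nonneg {s t : ℝ} (hs : s ≠ 0) (ht : 0 ≤ t) :
    Real.signedRpow s t = t ^ s := by
  rcases ht.eq_or_lt with rfl | ht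
  · simp [Real.signedRpow, Real.zero_rpow hs]
  · simp [Real.signedRpow, ht, abs_of_pos ht]

theorem Real.signedRpow_neg (s t : ℝ) : Real.signedRpow s (-t) = -Real.signedRpow s t := by
  simp [Real.signedRpow, Left.sign_neg]

theorem Real.continuous_signedRpow {s : ℝ} (hs : 0 < s) : Continuous (Real.signedRpow s) := by
  -- The sign jumps at 0; powers of the positive and negative parts make continuity visible.
  have h : Real.signedRpow s = fun t => (max t 0) ^ s - (max (-t) 0) ^ s := by
    ext t
    rcases le_total 0 t with ht | ht
    · rw [Real.signedRpow_of_nonneg hs.ne' ht, max_eq_left ht, max_eq_right (by linarith),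
        Real.zero_rpow hs.ne', sub_zero]
    · rw [← neg_neg t, Real.signedRpow_neg, Real.signedRpow_of_nonneg hs.ne' (by linarith), neg_neg,
        max_eq_right ht, max_eq_left (by linarith), Real.zero_rpow hs.ne', zero_sub]
  rw [h]
  exact ((continuous_id.max continuous_const).rpow_const fun _ => Or.inr hs.le).sub
    ((continuous_neg.max continuous_const).rpow_const fun _ => Or.inr hs.le)

theorem Real.signedRpow_mul_self (s t : ℝ) (hs : s ≠ 0) :
    Real.signedRpow s t * Real.signedRpow s t = (t * t) ^ s := by
  rw [← abs_mul_abs_self t, Real.mul_rpow (abs_nonneg t) (abs_nonneg t)]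
  rcases lt_trichotomy t 0 with ht | rfl | ht
  · simp [Real.signedRpow, ht]
  · simp [Real.signedRpow, Real.zero_rpow hs]
  · simp [Real.signedRpow, ht]

theorem Real.signedRpow_inv_signedRpow {s : ℝ} (hs : s ≠ 0) (t : ℝ) :
    Real.signedRpow s⁻¹ (Real.signedRpow s t) = t := by
  have key {t : ℝ} (ht : 0 ≤ t) : Real.signedRpow s⁻¹ (Real.signedRpow s t) = t := by
    rw [Real.signedRpow_of_nonneg hs ht,
      Real.signedRpow_of_nonneg (inv_ne_zero hs) (Real.rpow_nonneg ht s), Real.rpow_rpow_inv ht hs]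
  rcases le_total 0 t with ht | ht
  · exact key ht
  · have := key (neg_nonneg.2 ht)
    rw [Real.signedRpow_neg, Real.signedRpow_neg] at this
    linarith

/-- The signed power `v * |x| ^ s` of an element with polar decomposition `x = v * |x|`, as the
off-diagonal entry of an odd function of the self-adjoint matrix `offDiag x`. -/
noncomputable def signedPower (s : ℝ) (x : A) : A :=
  cfcₙ (Real.signedRpow s) (offDiag x) 0 1

theorem offDiag_signedPower {s : ℝ} (hs : 0 < s) (x : A) :
    offDiag (signedPower s x) = cfcₙ (Real.signedRpow s) (offDiag x) :=
  (cfcₙ_offDiag (Real.continuous_signedRpow hs) (Real.signedRpow_neg s) x).symm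

theorem Real.signedRpow_zero (s : ℝ) : Real.signedRpow s 0 = 0 := by simp [Real.signedRpow]

theorem map_signedPower (φ : A →⋆ₙₐ[ℂ] B) {s : ℝ} (hs : 0 < s) (x : A) :
    φ (signedPower s x) = signedPower s (φ x) := by
  have h := NonUnitalStarAlgHom.map_cfcₙ_real (mapₙₐ (n := Fin 2) φ)
    (Real.continuous_signedRpow hs) (Real.signedRpow_zero s) (isSelfAdjoint_offDiag x)
  rw [map_offDiag] at h
  exact congrFun (congrFun h 0) 1

theorem signedPower_inv_signedPower {s : ℝ} (hs : 0 < s) (x : A) :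
    signedPower s⁻¹ (signedPower s x) = x := by
  have hX := isSelfAdjoint_offDiag x
  rw [signedPower, offDiag_signedPower hs, ← cfcₙ_comp _ _ _
    (Real.continuous_signedRpow (inv_pos.2 hs)).continuousOn (Real.signedRpow_zero _)
    (Real.continuous_signedRpow hs).continuousOn (Real.signedRpow_zero _) hX]
  have : Real.signedRpow s⁻¹ ∘ Real.signedRpow s = id :=
    funext (Real.signedRpow_inv_signedRpow hs.ne')
  rw [this, cfcₙ_id ℝ _ hX]
  simp [offDiag]

/-- Squaring the odd function gives `(t * t) ^ s`, and the square of `offDiag x` is diagonal with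
first entry `x * star x`. -/
theorem signedPower_mul_star {s : ℝ} (hs : 0 < s) (x : A) :
    signedPower s x * star (signedPower s x) = cfcₙ (fun t : ℝ => t ^ s) (x * star x) := by
  have hX := isSelfAdjoint_offDiag x
  have hc := (Real.continuous_signedRpow hs).continuousOn (s := quasispectrum ℝ (offDiag x))
  have hp : Continuous fun t : ℝ => t ^ s := Real.continuous_rpow_const hs.le
  have hp0 : (0 : ℝ) ^ s = 0 := Real.zero_rpow hs.ne'
  have h1 : diagHom (signedPower s x * star (signedPower s x),
      star (signedPower s x) * signedPower s x) =
      diagHom (cfcₙ (fun t : ℝ => t ^ s) (x * star x), cfcₙ (fun t : ℝ => t ^ s) (star x * x)) := by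
    rw [← offDiag_mul_self, offDiag_signedPower hs,
      ← cfcₙ_mul _ _ _ hc (Real.signedRpow_zero s) hc (Real.signedRpow_zero s)]
    have ha := IsSelfAdjoint.mul_star_self x
    have hb := IsSelfAdjoint.star_mul_self x
    have hab : IsSelfAdjoint (x * star x, star x * x) := Prod.ext ha hb
    rw [← cfcₙ_map_prod (S := ℂ) _ _ _ hp.continuousOn hab ha hb,
      NonUnitalStarAlgHom.map_cfcₙ_real diagHom hp hp0 hab, ← offDiag_mul_self]
    have h2 : offDiag x * offDiag x = cfcₙ (fun t : ℝ => t * t) (offDiag x) := by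
      rw [cfcₙ_mul .., cfcₙ_id' ℝ _ hX]
    rw [h2, ← cfcₙ_comp' (fun t : ℝ => t ^ s) _ _ hp.continuousOn hp0 (by fun_prop) (by simp) hX]
    exact cfcₙ_congr fun t _ => Real.signedRpow_mul_self s t hs.ne'
  exact congrFun (congrFun h1 0) 0

end SignedPower

/-! ### Lifting row contractions -/

theorem abs_le_norm_of_mem_quasispectrum {A : Type*} [NonUnitalCStarAlgebra A] {a : A}
    (ha : IsSelfAdjoint a) {t : ℝ} (ht : t ∈ quasispectrum ℝ a) : |t| ≤ ‖a‖ := by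
  have h := norm_apply_le_norm_cfcₙ (id : ℝ → ℝ) a ht continuousOn_id rfl ha
  rwa [cfcₙ_id ℝ a ha] at h

/-- This is `(1 + f(a)) * a * (1 + f(a))`, expanded because there is no unit. -/
theorem cfcₙ_one_add_mul_self_mul_one_add {A : Type*} [NonUnitalCStarAlgebra A] {f : ℝ → ℝ}
    (hf : Continuous f) (h0 : f 0 = 0) {a : A} (ha : IsSelfAdjoint a) :
    a + cfcₙ f a * a + a * cfcₙ f a + cfcₙ f a * a * cfcₙ f a =
      cfcₙ (fun t => t + f t * t + t * f t + f t * t * f t) a := by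
  have c0 : ContinuousOn f (quasispectrum ℝ a) := hf.continuousOn
  have c1 : ContinuousOn (fun t : ℝ => t) (quasispectrum ℝ a) := continuousOn_id
  have c2 := c0.mul c1
  have c3 := c1.mul c0
  have c4 := c2.mul c0
  rw [cfcₙ_add (fun t => t + f t * t + t * f t) (fun t => f t * t * f t) a ((c1.add c2).add c3)
      (by simp) c4 (by simp), cfcₙ_add (fun t => t + f t * t) (fun t => t * f t) a (c1.add c2)
      (by simp) c3 (by simp), cfcₙ_add (fun t => t) (fun t => f t * t) a c1 rfl c2 (by simp),
    cfcₙ_mul (fun t => f t * t) f a c2 (by simp) c0 h0, cfcₙ_mul f (fun t => t) a c0 h0 c1 rfl,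
    cfcₙ_mul (fun t => t) f a c1 rfl c0 h0, cfcₙ_id' ℝ a ha]

/-- Row contractions lift through surjective ⋆-homomorphisms. -/
theorem exists_lift_rowContraction {ι : Type*} [Fintype ι] {A : Type*} {C : Type*}
    [NonUnitalCStarAlgebra A] [NonUnitalCStarAlgebra C] (ρ : A →⋆ₙₐ[ℂ] C)
    (hρ : Function.Surjective ρ) (z : ι → C) (hz : ‖∑ k, z k * star (z k)‖ ≤ 1) :
    ∃ a : ι → A, (∀ k, ρ (a k) = z k) ∧ ‖∑ k, a k * star (a k)‖ ≤ 1 := by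
  choose b hb using fun k => hρ (z k)
  set T : A := ∑ k, b k * star (b k) with hT
  have hTsa : IsSelfAdjoint T := isSelfAdjoint_sum _ fun k _ => IsSelfAdjoint.mul_star_self (b k)
  -- Chosen so that `(1 + f t) ^ 2 * t = t / max 1 |t|` has modulus at most 1, while `f` vanishes on
  -- `[-1, 1]`. Thus multiplying the lift by `1 + f(T)` makes it a row contraction without changing
  -- its image under `ρ`.
  let f : ℝ → ℝ := fun t => 1 / √(max 1 |t|) - 1
  have hpos (t : ℝ) : 0 < √(max 1 |t|) := Real.sqrt_pos.2 (by positivity)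
  have hf : Continuous f := by
    refine (continuous_const.div ?_ fun t => (hpos t).ne').sub continuous_const
    fun_prop
  have hf1 {t : ℝ} (ht : |t| ≤ 1) : f t = 0 := by simp [f, max_eq_left ht]
  have hf0 : f 0 = 0 := hf1 (by simp)
  set k : A := cfcₙ f T with hk
  have hksa : star k = k := cfcₙ_predicate (p := IsSelfAdjoint) f T
  have hρT : ρ T = ∑ j, z j * star (z j) := by simp [T, hb, map_star]
  have hρk : ρ k = 0 := by
    rw [hk, ρ.map_cfcₙ_real hf hf0 hTsa, ← cfcₙ_zero ℝ (ρ T)]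
    exact cfcₙ_congr fun t ht => hf1
      ((abs_le_norm_of_mem_quasispectrum (hTsa.map ρ) ht).trans (hρT ▸ hz))
  refine ⟨fun j => b j + k * b j, fun j => by simp [hρk, hb], ?_⟩
  have hsum : ∑ j, (b j + k * b j) * star (b j + k * b j) = T + k * T + T * k + k * T * k := by
    have h (j : ι) : (b j + k * b j) * star (b j + k * b j) =
        b j * star (b j) + k * (b j * star (b j)) + b j * star (b j) * k +
          k * (b j * star (b j)) * k := by
      simp only [star_add, star_mul, hksa, add_mul, mul_add, mul_assoc]
      abel
    simp only [h, Finset.sum_add_distrib, ← Finset.mul_sum, ← Finset.sum_mul, hT]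
  rw [hsum, cfcₙ_one_add_mul_self_mul_one_add hf hf0 hTsa]
  refine norm_cfcₙ_le fun t _ => ?_
  have hs := Real.sq_sqrt (show 0 ≤ max 1 |t| by positivity)
  have : t + f t * t + t * f t + f t * t * f t = t / max 1 |t| := by
    calc _ = t / √(max 1 |t|) ^ 2 := by simp only [f]; ring
      _ = _ := by rw [hs]
  rw [this, Real.norm_eq_abs, abs_div, abs_of_pos (show 0 < max 1 |t| by positivity)]
  exact div_le_one_of_le₀ (le_max_right _ _) (by positivity)

/-! ### The ball relation: naturality, lifting, boundedness -/

section Ball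

variable {A : Type u} {B : Type v} [NonUnitalCStarAlgebra A] [NonUnitalCStarAlgebra B] {r : ℕ}
  {p : ℝ≥0∞}

theorem isNCBallTuple_top {x : Fin r → A} : IsNCBallTuple ∞ x ↔ ∀ k, ‖x k‖ ≤ 1 := by
  rw [IsNCBallTuple, if_pos rfl]

theorem isNCBallTuple_of_ne_top (hp : p ≠ ∞) {x : Fin r → A} : IsNCBallTuple p x ↔
    ‖∑ k, cfcₙ (fun t : ℝ => t ^ (p.toReal / 2)) (x k * star (x k))‖ ≤ 1 := by
  rw [IsNCBallTuple, if_neg hp]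

theorem map_sum_rpow (φ : A →⋆ₙₐ[ℂ] B) {s : ℝ} (hs : 0 < s) (x : Fin r → A) :
    φ (∑ k, cfcₙ (fun t : ℝ => t ^ s) (x k * star (x k))) =
      ∑ k, cfcₙ (fun t : ℝ => t ^ s) (φ (x k) * star (φ (x k))) := by
  rw [map_sum]
  refine Finset.sum_congr rfl fun k _ => ?_
  rw [φ.map_cfcₙ_real (Real.continuous_rpow_const hs.le) (Real.zero_rpow hs.ne')
    (IsSelfAdjoint.mul_star_self _), map_mul, map_star]

theorem half_toReal_pos (hp : 0 < p) (hp' : p ≠ ∞) : 0 < p.toReal / 2 :=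
  half_pos (ENNReal.toReal_pos hp.ne' hp')

theorem IsNCBallTuple.map (hp : 0 < p) {x : Fin r → A} (hx : IsNCBallTuple p x)
    (φ : A →⋆ₙₐ[ℂ] B) : IsNCBallTuple p fun k => φ (x k) := by
  rcases eq_or_ne p ∞ with rfl | hp'
  · rw [isNCBallTuple_top] at hx ⊢
    exact fun k => (NonUnitalStarAlgHom.norm_apply_le φ (x k)).trans (hx k)
  · rw [isNCBallTuple_of_ne_top hp'] at hx ⊢
    rw [← map_sum_rpow φ (half_toReal_pos hp hp')]
    exact (NonUnitalStarAlgHom.norm_apply_le φ _).trans hx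

theorem IsNCBallTuple.of_map (hp : 0 < p) {x : Fin r → A} {φ : A →⋆ₙₐ[ℂ] B}
    (hφ : Function.Injective φ) (hx : IsNCBallTuple p fun k => φ (x k)) : IsNCBallTuple p x := by
  rcases eq_or_ne p ∞ with rfl | hp'
  · rw [isNCBallTuple_top] at hx ⊢
    exact fun k => (NonUnitalStarAlgHom.norm_map φ hφ (x k)).symm.trans_le (hx k)
  · rw [isNCBallTuple_of_ne_top hp'] at hx ⊢
    rw [← map_sum_rpow φ (half_toReal_pos hp hp'), NonUnitalStarAlgHom.norm_map φ hφ] at hx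
    exact hx

theorem isNCBallTuple_iff_signedPower (hp : 0 < p) (hp' : p ≠ ∞) {x : Fin r → A} :
    IsNCBallTuple p x ↔
      ‖∑ k, signedPower (p.toReal / 2) (x k) * star (signedPower (p.toReal / 2) (x k))‖ ≤ 1 := by
  simp only [isNCBallTuple_of_ne_top hp', signedPower_mul_star (half_toReal_pos hp hp')]

theorem norm_le_one_iff_norm_mul_star_le_one {a : A} : ‖a‖ ≤ 1 ↔ ‖a * star a‖ ≤ 1 := by
  rw [CStarRing.norm_self_mul_star, ← sq, sq_le_one_iff₀ (norm_nonneg a)]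

theorem IsNCBallTuple.exists_lift (hp : 0 < p) (ρ : A →⋆ₙₐ[ℂ] B) (hρ : Function.Surjective ρ)
    {z : Fin r → B} (hz : IsNCBallTuple p z) :
    ∃ a : Fin r → A, IsNCBallTuple p a ∧ ∀ k, ρ (a k) = z k := by
  rcases eq_or_ne p ∞ with rfl | hp'
  · rw [isNCBallTuple_top] at hz
    have h (k : Fin r) : ∃ a : A, ρ a = z k ∧ ‖a‖ ≤ 1 := by
      obtain ⟨a, ha, ha'⟩ := exists_lift_rowContraction ρ hρ (fun _ : Unit => z k)
        (by simpa using norm_le_one_iff_norm_mul_star_le_one.1 (hz k))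
      exact ⟨a (), ha (), norm_le_one_iff_norm_mul_star_le_one.2 (by simpa using ha')⟩
    choose a ha ha' using h
    exact ⟨a, isNCBallTuple_top.2 ha', ha⟩
  · have hs := half_toReal_pos hp hp'
    obtain ⟨a, ha, ha'⟩ := exists_lift_rowContraction ρ hρ _
      ((isNCBallTuple_iff_signedPower hp hp').1 hz)
    refine ⟨fun k => signedPower (p.toReal / 2)⁻¹ (a k),
      (isNCBallTuple_iff_signedPower hp hp').2 ?_, fun k => ?_⟩
    · have h (b : A) : signedPower (p.toReal / 2) (signedPower (p.toReal / 2)⁻¹ b) = b := by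
        simpa using signedPower_inv_signedPower (inv_pos.2 hs) b
      simpa only [h] using ha'
    · rw [map_signedPower ρ (inv_pos.2 hs), ha, signedPower_inv_signedPower hs]

/-- Each positive summand is dominated by the sum, and `t ^ (p / 2) ≤ 1` forces `t ≤ 1`. This bound
lets the coordinates of all models form elements of a bounded product. -/
theorem IsNCBallTuple.norm_le_one (hp : 0 < p) {x : Fin r → A} (hx : IsNCBallTuple p x)
    (k : Fin r) : ‖x k‖ ≤ 1 := by
  rcases eq_or_ne p ∞ with rfl | hp'
  · exact isNCBallTuple_top.1 hx k
  · have hs := half_toReal_pos hp hp'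
    rw [isNCBallTuple_of_ne_top hp'] at hx
    let _ := CStarAlgebra.spectralOrder A
    have _ := CStarAlgebra.spectralOrderedRing A
    have hnn (j : Fin r) : 0 ≤ x j * star (x j) := mul_star_self_nonneg (x j)
    have hpow (j : Fin r) : 0 ≤ cfcₙ (fun t : ℝ => t ^ (p.toReal / 2)) (x j * star (x j)) :=
      cfcₙ_nonneg fun t ht => Real.rpow_nonneg (quasispectrum_nonneg_of_nonneg _ (hnn j) t ht) _
    have hle : ‖cfcₙ (fun t : ℝ => t ^ (p.toReal / 2)) (x k * star (x k))‖ ≤ 1 :=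
      (CStarAlgebra.norm_le_norm_of_nonneg_of_le (hpow k)
        (Finset.single_le_sum (fun j _ => hpow j) (Finset.mem_univ k))).trans hx
    have hsa := IsSelfAdjoint.mul_star_self (x k)
    rw [norm_le_one_iff_norm_mul_star_le_one, ← cfcₙ_id ℝ (x k * star (x k)) hsa]
    refine norm_cfcₙ_le fun t ht => ?_
    have ht0 := quasispectrum_nonneg_of_nonneg _ (hnn k) t ht
    have h := (norm_apply_le_norm_cfcₙ (fun t : ℝ => t ^ (p.toReal / 2)) _ ht
      (Real.continuous_rpow_const hs.le).continuousOn (Real.zero_rpow hs.ne') hsa).trans hle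
    rw [Real.norm_of_nonneg (Real.rpow_nonneg ht0 _)] at h
    rw [id, Real.norm_of_nonneg ht0]
    by_contra! hlt
    exact h.not_gt (Real.one_lt_rpow hlt hs)

end Ball

/-! ### Construction of the universal algebra -/

theorem NonUnitalStarAlgHom.ext_of_dense_adjoin {A : Type*} {B : Type*} [NonUnitalCStarAlgebra A]
    [NonUnitalCStarAlgebra B] {s : Set A} (hs : Dense (NonUnitalStarAlgebra.adjoin ℂ s : Set A))
    {φ ψ : A →⋆ₙₐ[ℂ] B} (h : Set.EqOn φ ψ s) : φ = ψ := by
  have hle : NonUnitalStarAlgebra.adjoin ℂ s ≤ NonUnitalStarAlgHom.equalizer φ ψ :=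
    NonUnitalStarAlgebra.adjoin_le h
  exact DFunLike.coe_injective
    (φ.continuous_of_cstar.ext_on hs ψ.continuous_of_cstar fun a ha => hle ha)

theorem dense_adjoin_preimage_topologicalClosure {A : Type*} [NonUnitalCStarAlgebra A]
    (s : Set A) : Dense (NonUnitalStarAlgebra.adjoin ℂ
      ((↑) ⁻¹' s : Set (NonUnitalStarAlgebra.adjoin ℂ s).topologicalClosure) :
      Set (NonUnitalStarAlgebra.adjoin ℂ s).topologicalClosure) := by
  set S := (NonUnitalStarAlgebra.adjoin ℂ s).topologicalClosure
  have hs : s ⊆ S := fun a ha =>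
    NonUnitalStarSubalgebra.le_topologicalClosure _ (NonUnitalStarAlgebra.subset_adjoin ℂ s ha)
  have himage : ((↑) : S → A) '' (NonUnitalStarAlgebra.adjoin ℂ ((↑) ⁻¹' s : Set S) : Set S) =
      NonUnitalStarAlgebra.adjoin ℂ s := by
    have h := NonUnitalStarAlgHom.map_adjoin (NonUnitalStarSubalgebraClass.subtype S)
      ((↑) ⁻¹' s : Set S)
    have h' : (NonUnitalStarSubalgebraClass.subtype S : S → A) '' ((↑) ⁻¹' s) = s := by
      rw [show ⇑(NonUnitalStarSubalgebraClass.subtype S) = ((↑) : S → A) from rfl]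
      exact Set.image_preimage_eq_of_subset fun a ha => ⟨⟨a, hs ha⟩, rfl⟩
    rw [h'] at h
    exact congrArg (fun T : NonUnitalStarSubalgebra ℂ A => (T : Set A)) h
  rw [Topology.IsInducing.subtypeVal.dense_iff]
  exact fun a => himage ▸ a.2

/-- A C⋆-algebra carried by a set of sets of natural numbers, with a tuple in the noncommutative
ball. Up to isomorphism, all separable C⋆-algebras with such a tuple occur. -/
structure NCBallModel (r : ℕ) (p : ℝ≥0∞) : Type u where
  carrier : Set (Set ℕ)
  algebra : NonUnitalCStarAlgebra carrier
  tuple : Fin r → carrier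
  rel : IsNCBallTuple p tuple

namespace NCBallModel

/-- The underlying type of a model. -/
def Carrier {r : ℕ} {p : ℝ≥0∞} (m : NCBallModel.{u} r p) : Type := m.carrier

noncomputable instance {r : ℕ} {p : ℝ≥0∞} (m : NCBallModel.{u} r p) :
    NonUnitalCStarAlgebra m.Carrier := m.algebra

/-- The coordinates of the tuple of a model. -/
def coord {r : ℕ} {p : ℝ≥0∞} (m : NCBallModel.{u} r p) (k : Fin r) : m.Carrier := m.tuple k

theorem isNCBallTuple_coord {r : ℕ} {p : ℝ≥0∞} (m : NCBallModel.{u} r p) :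
    IsNCBallTuple p m.coord := m.rel

/-- Every tuple in the noncommutative ball is the image of the tuple of some model. -/
theorem exists_hom {r : ℕ} {p : ℝ≥0∞} (hp : 0 < p) {D : Type v} [NonUnitalCStarAlgebra D]
    {y : Fin r → D} (hy : IsNCBallTuple p y) :
    ∃ (m : NCBallModel.{u} r p) (φ : m.Carrier →⋆ₙₐ[ℂ] D), ∀ k, φ (m.coord k) = y k := by
  let S := (NonUnitalStarAlgebra.adjoin ℂ (Set.range y)).topologicalClosure
  have hclosed : IsClosed (S : Set D) := NonUnitalStarSubalgebra.isClosed_topologicalClosure _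
  have hsep : TopologicalSpace.SeparableSpace S :=
    (NonUnitalStarAlgebra.isSeparable_adjoin (Set.countable_range y)).closure.separableSpace
  have hmem (k : Fin r) : y k ∈ S := NonUnitalStarSubalgebra.le_topologicalClosure _
    (NonUnitalStarAlgebra.subset_adjoin ℂ _ ⟨k, rfl⟩)
  obtain ⟨f, hf⟩ := exists_injective_set_nat S
  obtain ⟨inst, φ, hφ⟩ :=
    exists_nonUnitalCStarAlgebra_of_equiv (Equiv.ofInjective f hf).symm
  choose t ht using fun k => hφ.2 ⟨y k, hmem k⟩
  let ψ : Set.range f →⋆ₙₐ[ℂ] D := (NonUnitalStarSubalgebraClass.subtype S).comp φ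
  have hψ (k : Fin r) : ψ (t k) = y k := congrArg Subtype.val (ht k)
  have hrel : IsNCBallTuple p t := .of_map hp (φ := ψ) (Subtype.val_injective.comp hφ.1)
    (by simpa only [hψ] using hy)
  exact ⟨⟨Set.range f, inst, t, hrel⟩, ψ, hψ⟩

end NCBallModel

/-- Evaluation at an index, as a ⋆-homomorphism on a bounded product of C⋆-algebras. -/
def lp.evalStarHom {ι : Type*} (E : ι → Type*) [∀ i, NonUnitalCStarAlgebra (E i)] (i : ι) :
    lp E ∞ →⋆ₙₐ[ℂ] E i where
  toFun f := f i
  map_smul' _ _ := rfl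
  map_zero' := rfl
  map_add' _ _ := rfl
  map_mul' _ _ := rfl
  map_star' _ := rfl

theorem isNCBallTuple_lp {ι : Type*} {E : ι → Type*} [∀ i, NonUnitalCStarAlgebra (E i)] {r : ℕ}
    {p : ℝ≥0∞} (hp : 0 < p) {x : Fin r → lp E ∞} (hx : ∀ i, IsNCBallTuple p fun k => x k i) :
    IsNCBallTuple p x := by
  rcases eq_or_ne p ∞ with rfl | hp'
  · exact isNCBallTuple_top.2 fun k => lp.norm_le_of_forall_le zero_le_one fun i =>
      isNCBallTuple_top.1 (hx i) k
  · rw [isNCBallTuple_of_ne_top hp']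
    refine lp.norm_le_of_forall_le zero_le_one fun i => ?_
    have h := map_sum_rpow (lp.evalStarHom E i) (half_toReal_pos hp hp') x
    exact (congrArg norm h).trans_le ((isNCBallTuple_of_ne_top hp').1 (hx i))

theorem exists_isUniversalNCBall (r : ℕ) {p : ℝ≥0∞} (hp : 0 < p) :
    ∃ (B : Type u) (_ : NonUnitalCStarAlgebra B) (x : Fin r → B),
      IsUniversalNCBall.{u, v} p B x := by
  -- The models have carriers in `Type` and are indexed by a type in universe `u`, so their product
  -- lies in `Type u` whatever the universe of the test algebras.
  let E : NCBallModel.{u} r p → Type := NCBallModel.Carrier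
  let X : Fin r → lp E ∞ := fun k => ⟨fun m => m.coord k, memℓp_infty
    ⟨1, by rintro _ ⟨m, rfl⟩; exact m.isNCBallTuple_coord.norm_le_one hp k⟩⟩
  have hX : IsNCBallTuple p X := isNCBallTuple_lp hp fun m => m.isNCBallTuple_coord
  let S := (NonUnitalStarAlgebra.adjoin ℂ (Set.range X)).topologicalClosure
  have hclosed : IsClosed (S : Set (lp E ∞)) :=
    NonUnitalStarSubalgebra.isClosed_topologicalClosure _
  have hmem (k : Fin r) : X k ∈ S := NonUnitalStarSubalgebra.le_topologicalClosure _
    (NonUnitalStarAlgebra.subset_adjoin ℂ _ ⟨k, rfl⟩)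
  let x : Fin r → S := fun k => ⟨X k, hmem k⟩
  have hrange : Set.range x = (↑) ⁻¹' Set.range X := by
    ext a
    exact exists_congr fun k => Subtype.ext_iff
  have hdense : Dense (NonUnitalStarAlgebra.adjoin ℂ (Set.range x) : Set S) := by
    rw [hrange]
    exact dense_adjoin_preimage_topologicalClosure _
  let ι : S →⋆ₙₐ[ℂ] lp E ∞ := NonUnitalStarSubalgebraClass.subtype S
  refine ⟨S, inferInstance, x, .of_map hp (φ := ι) Subtype.val_injective hX, hdense,
    fun D _ y hy => ?_⟩
  obtain ⟨m, φ, hφ⟩ := NCBallModel.exists_hom.{u} hp hy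
  refine ⟨φ.comp ((lp.evalStarHom E m).comp ι), hφ, fun ψ hψ => ?_⟩
  refine NonUnitalStarAlgHom.ext_of_dense_adjoin hdense ?_
  rintro _ ⟨k, rfl⟩
  exact (hψ k).trans (hφ k).symm

/-! ### Projectivity -/

theorem IsUniversalNCBall.isProjectiveCStar {r : ℕ} {p : ℝ≥0∞} (hp : 0 < p) {B : Type u}
    [NonUnitalCStarAlgebra B] {x : Fin r → B} (h : IsUniversalNCBall.{u, v} p B x) :
    IsProjectiveCStar.{u, v, w} B := by
  intro A C _ _ ρ hρ φ
  obtain ⟨a, ha, hρa⟩ := (h.rel.map hp φ).exists_lift hp ρ hρ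
  obtain ⟨ψ, hψ, -⟩ := h.existsUnique_hom A a ha
  -- `C` may lie in a different universe from the test algebras, so the two maps are compared
  -- through density of the generated subalgebra, not through uniqueness in the universal property.
  refine ⟨ψ, NonUnitalStarAlgHom.ext_of_dense_adjoin h.generates ?_⟩
  rintro _ ⟨k, rfl⟩
  simp [hψ, hρa]

theorem theorem5p3 (r : ℕ) (p : ℝ≥0∞) (hp : 0 < p) :
    (∃ (B : Type u) (_ : NonUnitalCStarAlgebra B) (x : Fin r → B),
      IsUniversalNCBall.{u, v} p B x) ∧
    ∀ (B : Type u) [NonUnitalCStarAlgebra B] (x : Fin r → B),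
      IsUniversalNCBall.{u, v} p B x → IsProjectiveCStar.{u, v, w} B :=
  ⟨exists_isUniversalNCBall r hp, fun _ _ _ h => h.isProjectiveCStar hp⟩
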